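/- Let $n\ge 2$ be an integer. Two matrices $X,Y\in M_n(\mathbb R)$ are similar if $Y=PXP^{-1}$ for some invertible $P\in M_n(\mathbb R)$. A natural normal cell of size $k\ge 1$ is the companion matrix of a polynomial $\lambda^k+a_{k-1}\lambda^{k-1}+\dots+a_1\lambda+a_0$ with real coefficients, i.e. the $k\times k$ matrix with entries $1$ on the superdiagonal, last row $(-a_0,-a_1,\dots,-a_{k-1})$, and all other entries $0$. For $1<m\le n$ let $$N_{m,n}=\{(n_1,\dots,n_m)\in\mathbb Z^m:\ 0<n_1\le\dots\le n_m,\ n_1+\dots+n_m=n\}.$$ Let $[A]_1$ be the set of natural normal cells of size $n$ with $a_{n-1}=0$. For $(n_1,\dots,n_m)\in N_{m,n}$ let $[A]_{(n_1,\dots,n_m)}$ be the set of block-diagonal matrices $\operatorname{diag}(A_1,\dots,A_m)$ such that each $A_i$ is a natural normal cell of size $n_i$, the characteristic polynomial of $A_j$ divides that of $A_{j+1}$ for $1\le j\le m-1$, and $\operatorname{tr}A_1+\dots+\operatorname{tr}A_m=0$. For $A\in M_n(\mathbb R)$ let $D_k(\lambda)$ be the monic greatest common divisor of all minors of order $k$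 of $\lambda I_n-A$ ($1\le k\le n$), let $D_0=1$, and call $d_k=D_k/D_{k-1}$, $k=1,\dots,n$, the invariant factors of $A$. Theorem. Consider the families $[A]_1$ and $[A]_{(n_1,\dots,n_m)}$ with $1<m<n$ and $(n_1,\dots,n_m)\in N_{m,n}$. 1. All matrices in these families are nonzero elements of $\mathfrak{sl}(n,\mathbb R)$ (the real traceless $n\times n$ matrices), and families with different labels are disjoint. 2. Every nonzero $X\in\mathfrak{sl}(n,\mathbb R)$ is similar to exactly one matrix belonging to one of these families. 3. For $m=n$, the only tuple in $N_{n,n}$ is $(1,\dots,1)$ and $[A]_{(1,\dots,1)}=\{0\}$; so the zero matrix is the only element of $\mathfrak{sl}(n,\mathbb R)$ not covered by 2. 4. Two matrices $X,Y\in\mathfrak{sl}(n,\mathbb R)$ are similar if and only if they have the same invariant factors. -/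

import Mathlib

open Matrix Polynomial

namespace SlClasses

/-- The natural normal cell: the `k × k` companion matrix of
`λ ^ k + a (k-1) λ ^ (k-1) + ⋯ + a 1 λ + a 0`, with `1` on the superdiagonal and last row
`-a 0, …, -a (k-1)`. -/
def naturalCell {k : ℕ} (a : Fin k → ℝ) : Matrix (Fin k) (Fin k) ℝ :=
  Matrix.of fun i j =>
    if (i : ℕ) + 1 = k then -a j else if (i : ℕ) + 1 = (j : ℕ) then 1 else 0

def IsNaturalCell {k : ℕ} (A : Matrix (Fin k) (Fin k) ℝ) : Prop :=
  ∃ a : Fin k → ℝ, A = naturalCell a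

/-- `N_{m,n}`: the tuples of `m` integers `0 < n_1 ≤ ⋯ ≤ n_m` with sum `n`. -/
def sizeTuples (m n : ℕ) : Set (Fin m → ℕ) :=
  {s | (∀ i, 0 < s i) ∧ Monotone s ∧ ∑ i, s i = n}

/-- `diag(A_1, …, A_m)` as an `n × n` matrix, the blocks placed along the diagonal in order. -/
def diagBlocks {m n : ℕ} (s : Fin m → ℕ) (h : ∑ i, s i = n)
    (A : (i : Fin m) → Matrix (Fin (s i)) (Fin (s i)) ℝ) : Matrix (Fin n) (Fin n) ℝ :=
  Matrix.reindex (finSigmaFinEquiv.trans (finCongr h)) (finSigmaFinEquiv.trans (finCongr h))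
    (Matrix.blockDiagonal' A)

/-- The family `[A]_1`: companion matrices of size `n` with `a_{n-1} = 0`. -/
def cellFamily (n : ℕ) : Set (Matrix (Fin n) (Fin n) ℝ) :=
  {R | ∃ a : Fin n → ℝ, (∀ i : Fin n, (i : ℕ) + 1 = n → a i = 0) ∧ R = naturalCell a}

/-- The family `[A]_{(n_1, …, n_m)}`. -/
def blockFamily {m n : ℕ} (s : sizeTuples m n) : Set (Matrix (Fin n) (Fin n) ℝ) :=
  {R | ∃ A : (i : Fin m) → Matrix (Fin (s.1 i)) (Fin (s.1 i)) ℝ,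
    (∀ i, IsNaturalCell (A i)) ∧
    (∀ i j : Fin m, (j : ℕ) = (i : ℕ) + 1 → (A i).charpoly ∣ (A j).charpoly) ∧
    ∑ i, (A i).trace = 0 ∧
    R = diagBlocks s.1 s.2.2.2 A}

/-- The labels of the families: `1`, or a tuple in `N_{m,n}` with `1 < m < n`. -/
inductive FamilyIndex (n : ℕ) : Type
  | cell : FamilyIndex n
  | blocks (m : ℕ) (one_lt : 1 < m) (lt : m < n) (s : sizeTuples m n) : FamilyIndex n

def family {n : ℕ} : FamilyIndex n → Set (Matrix (Fin n) (Fin n) ℝ)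
  | FamilyIndex.cell => cellFamily n
  | FamilyIndex.blocks _ _ _ s => blockFamily s

noncomputable section

/-- `D_k`: the normalized (monic or zero) greatest common divisor of all minors of order `k`,
with `D_0 = 1`. -/
def minorsGCD {n : ℕ} (P : Matrix (Fin n) (Fin n) ℝ[X]) (k : ℕ) : ℝ[X] :=
  letI : NormalizedGCDMonoid ℝ[X] := UniqueFactorizationMonoid.toNormalizedGCDMonoid ℝ[X]
  (Finset.univ : Finset ((Fin k ↪o Fin n) × (Fin k ↪o Fin n))).gcd
    fun e => (P.submatrix e.1 e.2).det

/-- The invariant factors `d_1, …, d_n` of a polynomial matrix, `d_k = D_k / D_{k-1}`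
(the division is exact, and `d_k = 0` when `D_k = 0`); `d_{k+1}` has index `k : Fin n`. -/
def polyInvariantFactors {n : ℕ} (P : Matrix (Fin n) (Fin n) ℝ[X]) : Fin n → ℝ[X] :=
  fun k => minorsGCD P ((k : ℕ) + 1) / minorsGCD P (k : ℕ)

/-- The invariant factors of a real matrix `A` are those of `λ I - A`. -/
def invariantFactors {n : ℕ} (A : Matrix (Fin n) (Fin n) ℝ) : Fin n → ℝ[X] :=
  polyInvariantFactors A.charmatrix

end

end SlClasses

/-! Similarity of real matrices reduces to equivalence of polynomial matrices: `A` and `B` are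
similar iff `λI - A` and `λI - B` differ by invertible left and right factors over `ℝ[X]`
(`isConj_of_matEquiv_charmatrix` and its converse). Over a Euclidean domain every square matrix is
equivalent to a diagonal one with a divisibility chain (`exists_matEquiv_diagonal`). The
ideal-theoretic content of the minors is unchanged by equivalence (`MatEquiv.dvd_minors`), so the
quotients `D_k / D_{k-1}` recover the monic chain. Hence invariant factors classify matrices up to
similarity.

The characteristic matrix of the cell of a monic `p` has Smith form `1, …, 1, p`. A block sum of
cells of `p_1 ∣ ⋯ ∣ p_m` therefore has invariant factors `1, …, 1, p_1, …, p_m`. Conversely, the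
nonconstant invariant factors of any matrix have degrees summing to `n` and give such a block sum,
so each class contains exactly one rational form.

The trace is a similarity invariant, so the traceless forms represent the classes in `sl(n, ℝ)`.
They are sorted by `m` and the degrees: `m = 1` is the single-cell family. When `m = n` all `p_i`
are the same linear polynomial, and zero trace forces it to be `λ`, giving the zero matrix. -/

namespace SlClasses

/-! ### Equivalence of square matrices over a commutative ring -/

section Equivalence

variable {ι κ R : Type*} [Fintype ι] [DecidableEq ι] [Fintype κ] [DecidableEq κ] [CommRing R]

/-- Equivalence of square matrices over a commutative ring: `B = U A V` with `U`, `V` invertible. -/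
def MatEquiv (A B : Matrix ι ι R) : Prop :=
  ∃ U V : (Matrix ι ι R)ˣ, (U : Matrix ι ι R) * A * (V : Matrix ι ι R) = B

theorem MatEquiv.refl (A : Matrix ι ι R) : MatEquiv A A := ⟨1, 1, by simp⟩

theorem MatEquiv.symm {A B : Matrix ι ι R} (h : MatEquiv A B) : MatEquiv B A := by
  obtain ⟨U, V, rfl⟩ := h
  exact ⟨U⁻¹, V⁻¹, by simp [Matrix.mul_assoc]⟩

theorem MatEquiv.trans {A B C : Matrix ι ι R} (h : MatEquiv A B) (h' : MatEquiv B C) :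
    MatEquiv A C := by
  obtain ⟨U, V, rfl⟩ := h
  obtain ⟨U', V', rfl⟩ := h'
  exact ⟨U' * U, V * V', by simp [Matrix.mul_assoc]⟩

theorem MatEquiv.of_mul_eq_one {A B U U' V V' : Matrix ι ι R} (hU : U * U' = 1) (hV : V * V' = 1)
    (h : U * A * V = B) : MatEquiv A B :=
  ⟨⟨U, U', hU, mul_eq_one_comm.1 hU⟩, ⟨V, V', hV, mul_eq_one_comm.1 hV⟩, h⟩

theorem MatEquiv.transpose {A B : Matrix ι ι R} (h : MatEquiv A B) : MatEquiv Aᵀ Bᵀ := by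
  obtain ⟨U, V, rfl⟩ := h
  refine MatEquiv.of_mul_eq_one (U := (V : Matrix ι ι R)ᵀ)
    (U' := ((V⁻¹ : (Matrix ι ι R)ˣ) : Matrix ι ι R)ᵀ) (V := (U : Matrix ι ι R)ᵀ)
    (V' := ((U⁻¹ : (Matrix ι ι R)ˣ) : Matrix ι ι R)ᵀ) ?_ ?_ ?_
  · rw [← Matrix.transpose_mul, Units.inv_mul, Matrix.transpose_one]
  · rw [← Matrix.transpose_mul, Units.inv_mul, Matrix.transpose_one]
  · simp [Matrix.transpose_mul, Matrix.mul_assoc]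

theorem MatEquiv.submatrix_equiv {A B : Matrix ι ι R} (h : MatEquiv A B) (e : κ ≃ ι) :
    MatEquiv (A.submatrix e e) (B.submatrix e e) := by
  obtain ⟨U, V, rfl⟩ := h
  refine MatEquiv.of_mul_eq_one (U := (U : Matrix ι ι R).submatrix e e)
    (U' := ((U⁻¹ : (Matrix ι ι R)ˣ) : Matrix ι ι R).submatrix e e)
    (V := (V : Matrix ι ι R).submatrix e e)
    (V' := ((V⁻¹ : (Matrix ι ι R)ˣ) : Matrix ι ι R).submatrix e e) ?_ ?_ ?_
  · rw [Matrix.submatrix_mul_equiv, Units.mul_inv, Matrix.submatrix_one_equiv]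
  · rw [Matrix.submatrix_mul_equiv, Units.mul_inv, Matrix.submatrix_one_equiv]
  · rw [Matrix.submatrix_mul_equiv, Matrix.submatrix_mul_equiv]

theorem matEquiv_submatrix_perm (A : Matrix ι ι R) (e f : Equiv.Perm ι) :
    MatEquiv A (A.submatrix e f) := by
  refine MatEquiv.of_mul_eq_one (U := (1 : Matrix ι ι R).submatrix e id)
    (U' := (1 : Matrix ι ι R).submatrix id e)
    (V := (1 : Matrix ι ι R).submatrix id f) (V' := (1 : Matrix ι ι R).submatrix f id) ?_ ?_ ?_
  · simpa using Matrix.submatrix_mul_equiv (1 : Matrix ι ι R) (1 : Matrix ι ι R) e (.refl _) e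
  · simp
  · have h1 := Matrix.submatrix_mul_equiv (1 : Matrix ι ι R) A e (.refl _) id
    have h2 := Matrix.submatrix_mul_equiv (A.submatrix e id) (1 : Matrix ι ι R) id (.refl _) f
    simp only [Equiv.coe_refl, Matrix.submatrix_id_id, Matrix.one_mul, Matrix.mul_one] at h1 h2
    rw [h1, h2]
    rfl

theorem MatEquiv.blockDiagonal' {o : Type*} [Fintype o] [DecidableEq o] {m : o → Type*}
    [∀ i, Fintype (m i)] [∀ i, DecidableEq (m i)] {A B : ∀ i, Matrix (m i) (m i) R}
    (h : ∀ i, MatEquiv (A i) (B i)) :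
    MatEquiv (Matrix.blockDiagonal' A) (Matrix.blockDiagonal' B) := by
  choose U V hUV using h
  refine MatEquiv.of_mul_eq_one (U := Matrix.blockDiagonal' fun i => (U i : Matrix (m i) (m i) R))
    (U' := Matrix.blockDiagonal' fun i => ((U i)⁻¹ : (Matrix (m i) (m i) R)ˣ).1)
    (V := Matrix.blockDiagonal' fun i => (V i : Matrix (m i) (m i) R))
    (V' := Matrix.blockDiagonal' fun i => ((V i)⁻¹ : (Matrix (m i) (m i) R)ˣ).1) ?_ ?_ ?_
  · rw [← Matrix.blockDiagonal'_mul]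
    simp only [Units.mul_inv]
    exact Matrix.blockDiagonal'_one
  · rw [← Matrix.blockDiagonal'_mul]
    simp only [Units.mul_inv]
    exact Matrix.blockDiagonal'_one
  · rw [← Matrix.blockDiagonal'_mul, ← Matrix.blockDiagonal'_mul]
    simp only [hUV]

/-- Adding multiples of one row to the other rows. -/
theorem matEquiv_add_row_mul (A : Matrix ι ι R) (i₀ : ι) (q : ι → R) (hq : q i₀ = 0) :
    MatEquiv A (Matrix.of fun i j => A i j + q i * A i₀ j) := by
  -- This rank-one matrix squares to zero because `q i₀ = 0`, so one plus it has inverse one minus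
  -- it.
  have hN : vecMulVec q (Pi.single i₀ 1) * vecMulVec q (Pi.single i₀ (1 : R)) = 0 := by
    rw [vecMulVec_mul_vecMulVec]
    simp [hq]
  refine MatEquiv.of_mul_eq_one (U := 1 + vecMulVec q (Pi.single i₀ 1))
    (U' := 1 - vecMulVec q (Pi.single i₀ 1)) (V := 1) (V' := 1) ?_ (by simp) ?_
  · rw [add_mul, mul_sub, mul_sub, hN]
    simp
  · ext i j
    rw [Matrix.mul_one, add_mul, Matrix.one_mul, Matrix.add_apply, Matrix.mul_apply]
    simp [vecMulVec_apply, Pi.single_apply]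

/-- Adding multiples of one column to the other columns. -/
theorem matEquiv_add_col_mul (A : Matrix ι ι R) (j₀ : ι) (q : ι → R) (hq : q j₀ = 0) :
    MatEquiv A (Matrix.of fun i j => A i j + q j * A i j₀) :=
  (matEquiv_add_row_mul Aᵀ j₀ q hq).transpose

theorem MatEquiv.smul {A B : Matrix ι ι R} (h : MatEquiv A B) (c : R) :
    MatEquiv (c • A) (c • B) := by
  obtain ⟨U, V, rfl⟩ := h
  exact ⟨U, V, by simp⟩

theorem matEquiv_diagonal_of_associated {d d' : ι → R} (h : ∀ i, Associated (d i) (d' i)) :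
    MatEquiv (diagonal d) (diagonal d') := by
  choose u hu using h
  refine MatEquiv.of_mul_eq_one (U := 1) (U' := 1) (V := diagonal fun i => (u i : R))
    (V' := diagonal fun i => ((u i)⁻¹ : Rˣ).1) (by simp) (by simp) ?_
  simp [hu]

theorem MatEquiv.associated_det {A B : Matrix ι ι R} (h : MatEquiv A B) :
    Associated A.det B.det := by
  obtain ⟨U, V, rfl⟩ := h
  rw [det_mul, det_mul]
  have hU : IsUnit (U : Matrix ι ι R).det := (Matrix.isUnit_iff_isUnit_det _).1 U.isUnit
  have hV : IsUnit (V : Matrix ι ι R).det := (Matrix.isUnit_iff_isUnit_det _).1 V.isUnit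
  exact ⟨hU.unit * hV.unit, by simp; ring⟩

end Equivalence

/-! ### Smith normal form -/

section Smith

variable {R : Type*}

/-- The block diagonal matrix with a `1 × 1` block `d` followed by the block `M`. -/
def consDiag [Zero R] {n : ℕ} (d : R) (M : Matrix (Fin n) (Fin n) R) :
    Matrix (Fin (n + 1)) (Fin (n + 1)) R :=
  Matrix.of (Fin.cons (Fin.cons d 0) fun i => Fin.cons 0 (M i))

theorem consDiag_mul [CommRing R] {n : ℕ} (a b : R) (M N : Matrix (Fin n) (Fin n) R) :
    consDiag a M * consDiag b N = consDiag (a * b) (M * N) := by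
  ext i j
  refine Fin.cases ?_ (fun i => ?_) i <;> refine Fin.cases ?_ (fun j => ?_) j <;>
    simp [consDiag, Matrix.mul_apply, Fin.sum_univ_succ]

theorem consDiag_one [CommRing R] {n : ℕ} :
    consDiag 1 (1 : Matrix (Fin n) (Fin n) R) = 1 := by
  ext i j
  refine Fin.cases ?_ (fun i => ?_) i <;> refine Fin.cases ?_ (fun j => ?_) j <;>
    simp [consDiag, Matrix.one_apply, Fin.succ_ne_zero, (Fin.succ_ne_zero _).symm]

theorem consDiag_diagonal [CommRing R] {n : ℕ} (a : R) (d : Fin n → R) :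
    consDiag a (diagonal d) = diagonal (Fin.cons a d) := by
  ext i j
  refine Fin.cases ?_ (fun i => ?_) i <;> refine Fin.cases ?_ (fun j => ?_) j <;>
    simp [consDiag, Matrix.diagonal_apply, Fin.succ_ne_zero, (Fin.succ_ne_zero _).symm]

theorem MatEquiv.consDiag [CommRing R] {n : ℕ} {M N : Matrix (Fin n) (Fin n) R}
    (h : MatEquiv M N) (a : R) : MatEquiv (consDiag a M) (consDiag a N) := by
  obtain ⟨U, V, rfl⟩ := h
  refine MatEquiv.of_mul_eq_one (U := SlClasses.consDiag 1 (U : Matrix (Fin n) (Fin n) R))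
    (U' := SlClasses.consDiag 1 (U⁻¹ : (Matrix (Fin n) (Fin n) R)ˣ).1)
    (V := SlClasses.consDiag 1 (V : Matrix (Fin n) (Fin n) R))
    (V' := SlClasses.consDiag 1 (V⁻¹ : (Matrix (Fin n) (Fin n) R)ˣ).1) ?_ ?_ ?_ <;>
    simp [consDiag_mul, consDiag_one]

variable [EuclideanDomain R]

/-- Choose a nonzero value minimal for the Euclidean order among all entries of all matrices
equivalent to `A`; swaps bring it to the corner. -/
theorem exists_matEquiv_minimal_entry {n : ℕ} (A : Matrix (Fin (n + 1)) (Fin (n + 1)) R)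
    (hA : A ≠ 0) : ∃ B, MatEquiv A B ∧ B 0 0 ≠ 0 ∧
      ∀ C, MatEquiv A C → ∀ i j, C i j ≠ 0 → ¬ EuclideanDomain.r (C i j) (B 0 0) := by
  let S : Set R := {x | x ≠ 0 ∧ ∃ C, MatEquiv A C ∧ ∃ i j, C i j = x}
  have hS : S.Nonempty := by
    by_contra h
    refine hA (Matrix.ext fun i j => ?_)
    by_contra h0
    exact h ⟨A i j, h0, A, .refl A, i, j, rfl⟩
  have wf := EuclideanDomain.r_wellFounded (R := R)
  obtain ⟨h0, C, hC, i, j, hij⟩ := wf.min_mem S hS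
  have hB : (C.submatrix (Equiv.swap 0 i) (Equiv.swap 0 j)) 0 0 = wf.min S hS := by simp [hij]
  refine ⟨C.submatrix (Equiv.swap 0 i) (Equiv.swap 0 j),
    hC.trans (matEquiv_submatrix_perm _ _ _), by rwa [hB], fun D hD k l hkl => ?_⟩
  rw [hB]
  exact wf.not_lt_min S ⟨hkl, D, hD, k, l, rfl⟩

/-- A minimal corner entry divides its row and column, since otherwise a division step would produce
a smaller nonzero remainder. It can thus be used to clear both. -/
theorem exists_matEquiv_consDiag {n : ℕ} (A : Matrix (Fin (n + 1)) (Fin (n + 1)) R)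
    (hA : A ≠ 0) : ∃ d M, MatEquiv A (consDiag d (d • M)) := by
  obtain ⟨B, hAB, hd, hmin⟩ := exists_matEquiv_minimal_entry A hA
  generalize hdB : B 0 0 = d at hd hmin
  have hcol : ∀ C, MatEquiv A C → C 0 0 = d → ∀ i, d ∣ C i 0 := by
    intro C hC hCd i
    rcases eq_or_ne i 0 with rfl | hi
    · rw [hCd]
    have hq : (Pi.single i (-(C i 0 / d)) : Fin (n + 1) → R) 0 = 0 := by simp [hi.symm]
    have h := hmin _ (hC.trans (matEquiv_add_row_mul C 0 _ hq)) i 0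
    simp only [of_apply, Pi.single_eq_same, hCd] at h
    have he : C i 0 + -(C i 0 / d) * d = C i 0 % d := by
      rw [EuclideanDomain.mod_eq_sub_mul_div]; ring
    rw [he] at h
    rw [← EuclideanDomain.mod_eq_zero]
    by_contra h0
    exact h h0 (EuclideanDomain.mod_lt _ hd)
  have hrow : ∀ C, MatEquiv A C → C 0 0 = d → ∀ j, d ∣ C 0 j := by
    intro C hC hCd j
    rcases eq_or_ne j 0 with rfl | hj
    · rw [hCd]
    have hq : (Pi.single j (-(C 0 j / d)) : Fin (n + 1) → R) 0 = 0 := by simp [hj.symm]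
    have h := hmin _ (hC.trans (matEquiv_add_col_mul C 0 _ hq)) 0 j
    simp only [of_apply, Pi.single_eq_same, hCd] at h
    have he : C 0 j + -(C 0 j / d) * d = C 0 j % d := by
      rw [EuclideanDomain.mod_eq_sub_mul_div]; ring
    rw [he] at h
    rw [← EuclideanDomain.mod_eq_zero]
    by_contra h0
    exact h h0 (EuclideanDomain.mod_lt _ hd)
  obtain ⟨C, hAC, hCd, hC⟩ : ∃ C, MatEquiv A C ∧ C 0 0 = d ∧ ∀ i : Fin n, C i.succ 0 = 0 := by
    choose q hq using hcol B hAB hdB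
    refine ⟨_, hAB.trans (matEquiv_add_row_mul B 0 (Fin.cons 0 fun i => -q i.succ) rfl), ?_, ?_⟩
    · simp [hdB]
    · intro i
      simp only [of_apply, Fin.cons_succ, hdB, hq i.succ]
      ring
  obtain ⟨D, hAD, hDd, hDc, hDr⟩ : ∃ D, MatEquiv A D ∧ D 0 0 = d ∧
      (∀ i : Fin n, D i.succ 0 = 0) ∧ ∀ j : Fin n, D 0 j.succ = 0 := by
    choose q hq using hrow C hAC hCd
    refine ⟨_, hAC.trans (matEquiv_add_col_mul C 0 (Fin.cons 0 fun i => -q i.succ) rfl),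
      ?_, ?_, ?_⟩
    · simp [hCd]
    · intro i
      simp [hC]
    · intro j
      simp only [of_apply, Fin.cons_succ, hCd, hq j.succ]
      ring
  -- Adding row `i.succ` to row `0` keeps the corner equal to `d` and brings the entry into the top
  -- row, where `hrow` applies.
  have hdvd : ∀ i j : Fin n, d ∣ D i.succ j.succ := by
    intro i j
    have h := hrow _ (hAD.trans (matEquiv_add_row_mul D i.succ (Pi.single 0 1) (by simp)))
      (by simp [hDd, hDc]) j.succ
    simpa [hDr] using h
  choose M hM using hdvd
  refine ⟨d, Matrix.of M, ?_⟩
  convert hAD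
  ext i j
  refine Fin.cases ?_ (fun i => ?_) i <;> refine Fin.cases ?_ (fun j => ?_) j <;>
    simp [consDiag, hDd, hDc, hDr, hM]

/-- Smith normal form over a Euclidean domain. -/
theorem exists_matEquiv_diagonal : ∀ {n : ℕ} (A : Matrix (Fin n) (Fin n) R),
    ∃ d : Fin n → R, (∀ i j, i ≤ j → d i ∣ d j) ∧ MatEquiv A (diagonal d)
  | 0, A => ⟨0, fun i => i.elim0, by rw [Subsingleton.elim A (diagonal 0)]; exact .refl _⟩
  | n + 1, A => by
    by_cases hA : A = 0
    · exact ⟨0, fun _ _ _ => dvd_rfl, by rw [hA, diagonal_zero']; exact .refl _⟩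
    obtain ⟨a, M, hM⟩ := exists_matEquiv_consDiag A hA
    obtain ⟨d, hd, hMd⟩ := exists_matEquiv_diagonal M
    -- The lower block is `a • M`, so the Smith form of `M` scaled by `a` continues a chain starting
    -- at `a`.
    refine ⟨Fin.cons a (a • d), fun i j => ?_, ?_⟩
    · refine Fin.cases ?_ (fun i => ?_) i <;> refine Fin.cases ?_ (fun j => ?_) j
      · simp
      · simp
      · simp
      · intro h
        simpa using mul_dvd_mul_left a (hd i j (by simpa using h))
    · rw [← consDiag_diagonal]
      have h := (hMd.smul a).consDiag a
      rw [← diagonal_smul] at h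
      exact hM.trans h

end Smith

/-! ### Similarity and equivalence of characteristic matrices -/

section Similarity

/-- Evaluation with coefficients on the left is not multiplicative over a noncommutative ring. Here
the intertwining relation moves powers of `b` across `Q(b)`, turning them into powers of `a`. -/
theorem eval_mul_of_commute {S : Type*} [Ring S] (P Q : S[X]) (a b : S)
    (h : Q.eval b * b = a * Q.eval b) : (P * Q).eval b = P.eval a * Q.eval b := by
  have hpow : ∀ k : ℕ, Q.eval b * b ^ k = a ^ k * Q.eval b := by
    intro k
    induction k with
    | zero => simp
    | succ k ih => rw [pow_succ, ← mul_assoc, ih, mul_assoc, h, ← mul_assoc, ← pow_succ]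
  induction P using Polynomial.induction_on' with
  | add p q hp hq => rw [add_mul, eval_add, eval_add, hp, hq, add_mul]
  | monomial k c =>
    rw [← C_mul_X_pow_eq_monomial, mul_assoc, X_pow_mul, eval_C_mul, eval_mul_X_pow, hpow,
      eval_C_mul, eval_X_pow, mul_assoc]

/-- Right evaluation at `a` kills the multiple of `X - C a`; what remains is the intertwining
relation. -/
theorem eval_mul_eq_mul_eval_of_X_sub_C_mul_eq {S : Type*} [Ring S] {U V : S[X]} {a b : S}
    (h : (X - C b) * V = U * (X - C a)) : V.eval a * a = b * V.eval a := by
  have := congrArg (eval a) h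
  rw [eval_mul_X_sub_C, sub_mul, eval_sub, eval_C_mul, X_mul, eval_mul_X, sub_eq_zero] at this
  exact this

variable {n : Type*} [Fintype n] [DecidableEq n] {K : Type*} [CommRing K]

/-- Matrices with equivalent characteristic matrices are similar. -/
theorem isConj_of_matEquiv_charmatrix {A B : Matrix n n K}
    (h : MatEquiv A.charmatrix B.charmatrix) : IsConj A B := by
  obtain ⟨U, V, h⟩ := h
  have h1 : B.charmatrix * (V⁻¹ : (Matrix n n K[X])ˣ).1 = U.1 * A.charmatrix := by
    rw [← h]; simp [Matrix.mul_assoc]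
  have h2 : A.charmatrix * V.1 = (U⁻¹ : (Matrix n n K[X])ˣ).1 * B.charmatrix := by
    rw [← h]; simp [← Matrix.mul_assoc]
  apply_fun matPolyEquiv at h1 h2
  simp only [map_mul, matPolyEquiv_charmatrix] at h1 h2
  have e1 := eval_mul_eq_mul_eval_of_X_sub_C_mul_eq h1
  have e2 := eval_mul_eq_mul_eval_of_X_sub_C_mul_eq h2
  -- The conjugating matrix is `V⁻¹` evaluated at `A`; its inverse is `V` evaluated at `B`.
  have hone : (matPolyEquiv (V⁻¹ : (Matrix n n K[X])ˣ).1).eval A *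
      (matPolyEquiv V.1).eval B = 1 := by
    rw [← eval_mul_of_commute _ _ _ _ e2, ← map_mul, Units.inv_mul, map_one, eval_one]
  exact ⟨⟨_, _, hone, mul_eq_one_comm.1 hone⟩, e1⟩

theorem matEquiv_charmatrix_of_isConj {A B : Matrix n n K} (h : IsConj A B) :
    MatEquiv A.charmatrix B.charmatrix := by
  obtain ⟨P, hP⟩ := h
  have hP' : P.1 * A = B * P.1 := hP
  refine MatEquiv.of_mul_eq_one (U := P.1.map C) (U' := (P⁻¹ : (Matrix n n K)ˣ).1.map C)
    (V := (P⁻¹ : (Matrix n n K)ˣ).1.map C) (V' := P.1.map C) ?_ ?_ ?_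
  · rw [← Matrix.map_mul, Units.mul_inv]; simp
  · rw [← Matrix.map_mul, Units.inv_mul]; simp
  · apply matPolyEquiv.injective
    rw [map_mul, map_mul, matPolyEquiv_charmatrix, matPolyEquiv_charmatrix, matPolyEquiv_map_C,
      matPolyEquiv_map_C, mul_sub, ← C_mul, hP', ← X_mul_C, C_mul, ← sub_mul, mul_assoc, ← C_mul,
      Units.mul_inv, C_1, mul_one]

end Similarity

/-! ### Common divisors of minors -/

section Minors

variable {R : Type*} [CommRing R] {n k : ℕ}

/-- Sorting an injective row selection changes the minor only by a sign, and a repeated row makes it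
zero. -/
theorem dvd_det_submatrix_of_orderEmb_rows {m : Type*} (P : Matrix (Fin n) m R) {c : R}
    {f : Fin k → m} (h : ∀ e : Fin k ↪o Fin n, c ∣ (P.submatrix e f).det) (g : Fin k → Fin n) :
    c ∣ (P.submatrix g f).det := by
  by_cases hg : Function.Injective g
  · have hmono : StrictMono (g ∘ Tuple.sort g) :=
      (Tuple.monotone_sort g).strictMono_of_injective (hg.comp (Tuple.sort g).injective)
    have h1 := h (OrderEmbedding.ofStrictMono _ hmono)
    have h2 : P.submatrix (OrderEmbedding.ofStrictMono _ hmono) f =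
        (P.submatrix g f).submatrix (Tuple.sort g) id := rfl
    rw [h2, det_permute] at h1
    exact (IsUnit.dvd_mul_left ((Equiv.Perm.sign (Tuple.sort g)).isUnit.map
      (Int.castRingHom R))).1 h1
  · simp only [Function.Injective, not_forall] at hg
    obtain ⟨i, j, hij, hne⟩ := hg
    rw [det_zero_of_row_eq hne (by ext x; simp [hij])]
    exact dvd_zero c

theorem dvd_det_submatrix_of_orderEmb (P : Matrix (Fin n) (Fin n) R) {c : R}
    (h : ∀ e f : Fin k ↪o Fin n, c ∣ (P.submatrix e f).det) (g g' : Fin k → Fin n) :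
    c ∣ (P.submatrix g g').det := by
  refine dvd_det_submatrix_of_orderEmb_rows P (fun e => ?_) g
  rw [← det_transpose, transpose_submatrix]
  refine dvd_det_submatrix_of_orderEmb_rows Pᵀ (fun f => ?_) g'
  rw [← transpose_submatrix, det_transpose]
  exact h e f

/-- Multilinear expansion in the rows replaces Cauchy–Binet. It yields arbitrary row selections,
hence the quantification over all functions. -/
theorem dvd_det_submatrix_mul_left (U P : Matrix (Fin n) (Fin n) R) {c : R}
    (h : ∀ g g' : Fin k → Fin n, c ∣ (P.submatrix g g').det) (g g' : Fin k → Fin n) :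
    c ∣ ((U * P).submatrix g g').det := by
  have hrow : (U * P).submatrix g g' = fun i => ∑ x, U (g i) x • fun j => P x (g' j) := by
    ext i j
    simp [Matrix.mul_apply]
  change c ∣ detRowAlternating.toMultilinearMap ((U * P).submatrix g g')
  rw [hrow, MultilinearMap.map_sum]
  refine Finset.dvd_sum fun r _ => ?_
  rw [MultilinearMap.map_smul_univ]
  exact Dvd.dvd.mul_left (h r g') _

theorem dvd_det_submatrix_mul_right (P V : Matrix (Fin n) (Fin n) R) {c : R}
    (h : ∀ g g' : Fin k → Fin n, c ∣ (P.submatrix g g').det) (g g' : Fin k → Fin n) :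
    c ∣ ((P * V).submatrix g g').det := by
  rw [← det_transpose, transpose_submatrix, transpose_mul]
  refine dvd_det_submatrix_mul_left Vᵀ Pᵀ (fun g g' => ?_) g' g
  rw [← transpose_submatrix, det_transpose]
  exact h g' g

theorem MatEquiv.dvd_minors {P Q : Matrix (Fin n) (Fin n) R} (hPQ : MatEquiv P Q) {c : R}
    (h : ∀ e f : Fin k ↪o Fin n, c ∣ (P.submatrix e f).det) (e f : Fin k ↪o Fin n) :
    c ∣ (Q.submatrix e f).det := by
  obtain ⟨U, V, rfl⟩ := hPQ
  exact dvd_det_submatrix_mul_right _ _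
    (dvd_det_submatrix_mul_left _ _ (dvd_det_submatrix_of_orderEmb P h)) e f

theorem val_le_orderEmb (e : Fin k ↪o Fin n) (i : Fin k) : (i : ℕ) ≤ e i := by
  obtain ⟨i, hi⟩ := i
  induction i with
  | zero => exact Nat.zero_le _
  | succ i ih =>
    have h1 := ih (by omega)
    have h2 : e ⟨i, by omega⟩ < e ⟨i + 1, hi⟩ := e.strictMono (by simp)
    simp only [Fin.lt_def] at h2 h1 ⊢
    omega

/-- A principal minor is a product whose `i`-th index is at least `i`; a nonprincipal minor has a
zero row. -/
theorem prod_dvd_minor_diagonal {d : Fin n → R} (hd : ∀ i j, i ≤ j → d i ∣ d j) (hk : k ≤ n)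
    (e f : Fin k ↪o Fin n) :
    ∏ i : Fin k, d (i.castLE hk) ∣ ((diagonal d).submatrix e f).det := by
  by_cases hef : Set.range e = Set.range f
  · have : e = f := by
      apply RelEmbedding.ext
      intro i
      exact congrFun ((StrictMono.range_inj e.strictMono f.strictMono).1 hef) i
    subst this
    have h : (diagonal d).submatrix e e = diagonal (d ∘ e) :=
      submatrix_diagonal_embedding d e.toEmbedding
    rw [h, det_diagonal]
    exact Finset.prod_dvd_prod_of_dvd _ _ fun i _ => hd _ _ (val_le_orderEmb e i)
  · obtain ⟨i, hi⟩ : ∃ i, ∀ j, e i ≠ f j := by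
      by_contra! hcon
      choose g hg using hcon
      apply hef
      have hgi : Function.Injective g := fun a b hab => e.injective (by rw [hg, hg, hab])
      have hgs := Finite.surjective_of_injective hgi
      rw [← hgs.range_comp f]
      congr 1
      exact funext hg
    rw [det_eq_zero_of_row_eq_zero i fun j => by simp [hi j]]
    exact dvd_zero _

end Minors

/-! ### Invariant factors as a complete similarity invariant -/

section InvariantFactors

variable {n : ℕ}

theorem dvd_minorsGCD_iff {P : Matrix (Fin n) (Fin n) ℝ[X]} {k : ℕ} {c : ℝ[X]} :
    c ∣ minorsGCD P k ↔ ∀ e f : Fin k ↪o Fin n, c ∣ (P.submatrix e f).det := by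
  let _ : NormalizedGCDMonoid ℝ[X] := UniqueFactorizationMonoid.toNormalizedGCDMonoid ℝ[X]
  rw [minorsGCD, Finset.dvd_gcd_iff]
  simp

theorem normalize_minorsGCD (P : Matrix (Fin n) (Fin n) ℝ[X]) (k : ℕ) :
    normalize (minorsGCD P k) = minorsGCD P k := by
  let _ : NormalizedGCDMonoid ℝ[X] := UniqueFactorizationMonoid.toNormalizedGCDMonoid ℝ[X]
  exact Finset.normalize_gcd

/-- A normalized element is determined by its divisors, so it suffices to compare common divisors.
-/
theorem minorsGCD_eq_of_forall_dvd_iff {P : Matrix (Fin n) (Fin n) ℝ[X]} {k : ℕ} {x : ℝ[X]}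
    (hx : normalize x = x)
    (h : ∀ c, c ∣ x ↔ ∀ e f : Fin k ↪o Fin n, c ∣ (P.submatrix e f).det) :
    minorsGCD P k = x :=
  dvd_antisymm_of_normalize_eq (normalize_minorsGCD P k) hx
    ((h _).2 (dvd_minorsGCD_iff.1 dvd_rfl)) (dvd_minorsGCD_iff.2 ((h _).1 dvd_rfl))

theorem MatEquiv.minorsGCD_eq {P Q : Matrix (Fin n) (Fin n) ℝ[X]} (h : MatEquiv P Q) (k : ℕ) :
    minorsGCD P k = minorsGCD Q k :=
  minorsGCD_eq_of_forall_dvd_iff (normalize_minorsGCD Q k) fun c => by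
    rw [dvd_minorsGCD_iff]
    exact ⟨fun hc => h.symm.dvd_minors hc, fun hc => h.dvd_minors hc⟩

theorem MatEquiv.polyInvariantFactors_eq {P Q : Matrix (Fin n) (Fin n) ℝ[X]} (h : MatEquiv P Q) :
    polyInvariantFactors P = polyInvariantFactors Q := by
  funext k
  simp [polyInvariantFactors, h.minorsGCD_eq]

/-- The product divides every minor and is itself the leading principal one. -/
theorem minorsGCD_diagonal {d : Fin n → ℝ[X]} (hd : ∀ i j, i ≤ j → d i ∣ d j)
    (hm : ∀ i, (d i).Monic) {k : ℕ} (hk : k ≤ n) :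
    minorsGCD (diagonal d) k = ∏ i : Fin k, d (i.castLE hk) := by
  refine minorsGCD_eq_of_forall_dvd_iff
    (monic_prod_of_monic _ _ fun i _ => hm _).normalize_eq_self fun c =>
      ⟨fun hc e f => ?_, fun h => ?_⟩
  · exact hc.trans (prod_dvd_minor_diagonal hd hk e f)
  · have h1 := h (Fin.castLEOrderEmb hk) (Fin.castLEOrderEmb hk)
    have h2 : (diagonal d).submatrix (Fin.castLEOrderEmb hk) (Fin.castLEOrderEmb hk) =
        diagonal (d ∘ Fin.castLEOrderEmb hk) :=
      submatrix_diagonal_embedding d (Fin.castLEOrderEmb hk).toEmbedding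
    rw [h2, det_diagonal] at h1
    exact h1

theorem polyInvariantFactors_diagonal {d : Fin n → ℝ[X]} (hd : ∀ i j, i ≤ j → d i ∣ d j)
    (hm : ∀ i, (d i).Monic) : polyInvariantFactors (diagonal d) = d := by
  funext k
  have hk : (k : ℕ) + 1 ≤ n := k.isLt
  rw [polyInvariantFactors, minorsGCD_diagonal hd hm hk, minorsGCD_diagonal hd hm k.isLt.le,
    Fin.prod_univ_castSucc]
  have h0 : ∏ i : Fin (k : ℕ), d (i.castLE k.isLt.le) ≠ 0 :=
    (monic_prod_of_monic _ _ fun i _ => hm _).ne_zero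
  exact mul_div_cancel_left₀ _ h0

theorem exists_monic_matEquiv_diagonal (P : Matrix (Fin n) (Fin n) ℝ[X]) (hP : P.det ≠ 0) :
    ∃ d : Fin n → ℝ[X], (∀ i j, i ≤ j → d i ∣ d j) ∧ (∀ i, (d i).Monic) ∧
      MatEquiv P (diagonal d) := by
  obtain ⟨d, hd, hPd⟩ := exists_matEquiv_diagonal P
  have h0 : ∀ i, d i ≠ 0 := by
    have := hPd.associated_det.ne_zero_iff.1 hP
    rw [det_diagonal, Finset.prod_ne_zero_iff] at this
    exact fun i => this i (Finset.mem_univ i)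
  refine ⟨fun i => normalize (d i), fun i j hij =>
      normalize_dvd_iff.2 (dvd_normalize_iff.2 (hd i j hij)),
    fun i => monic_normalize (h0 i), hPd.trans (matEquiv_diagonal_of_associated fun i => ?_)⟩
  exact (normalize_associated (d i)).symm

/-- The Smith normal form of `λ I - A` displays the invariant factors of `A`. -/
theorem charmatrix_matEquiv_diagonal_invariantFactors (A : Matrix (Fin n) (Fin n) ℝ) :
    (∀ i j, i ≤ j → invariantFactors A i ∣ invariantFactors A j) ∧
      (∀ i, (invariantFactors A i).Monic) ∧
      MatEquiv A.charmatrix (diagonal (invariantFactors A)) := by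
  obtain ⟨d, hd, hm, h⟩ := exists_monic_matEquiv_diagonal A.charmatrix A.charpoly_monic.ne_zero
  have : invariantFactors A = d := by
    rw [invariantFactors, h.polyInvariantFactors_eq, polyInvariantFactors_diagonal hd hm]
  rw [this]
  exact ⟨hd, hm, h⟩

/-- Real matrices are similar if and only if they have the same invariant factors. -/
theorem isConj_iff_invariantFactors_eq (A B : Matrix (Fin n) (Fin n) ℝ) :
    IsConj A B ↔ invariantFactors A = invariantFactors B := by
  refine ⟨fun h => (matEquiv_charmatrix_of_isConj h).polyInvariantFactors_eq, fun h => ?_⟩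
  have hA := (charmatrix_matEquiv_diagonal_invariantFactors A).2.2
  have hB := (charmatrix_matEquiv_diagonal_invariantFactors B).2.2
  rw [← h] at hB
  exact isConj_of_matEquiv_charmatrix (hA.trans hB.symm)

end InvariantFactors

/-! ### Characteristic polynomial and Smith form of a cell -/

section Cells

/-- The polynomial `λ ^ k + a (k-1) λ ^ (k-1) + ⋯ + a 0`. -/
noncomputable def cellPoly {k : ℕ} (a : Fin k → ℝ) : ℝ[X] := X ^ k + ∑ i, C (a i) * X ^ (i : ℕ)

theorem cellPoly_monic {k : ℕ} (a : Fin k → ℝ) : (cellPoly a).Monic :=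
  monic_X_pow_add (degree_sum_fin_lt a)

theorem natDegree_cellPoly {k : ℕ} (a : Fin k → ℝ) : (cellPoly a).natDegree = k :=
  natDegree_eq_of_degree_eq_some <| by
    rw [cellPoly, degree_add_eq_left_of_degree_lt] <;> rw [degree_X_pow]
    exact degree_sum_fin_lt a

theorem coeff_cellPoly {k : ℕ} (a : Fin k → ℝ) (j : Fin k) : (cellPoly a).coeff j = a j := by
  rw [cellPoly, coeff_add, coeff_X_pow, if_neg j.isLt.ne, zero_add, finsetSum_coeff,
    Finset.sum_eq_single j]
  · simp
  · intro i _ hij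
    rw [coeff_C_mul, coeff_X_pow, if_neg (fun h => hij (Fin.ext h.symm)), mul_zero]
  · simp

theorem cellPoly_coeff {p : ℝ[X]} (hp : p.Monic) :
    cellPoly (fun j : Fin p.natDegree => p.coeff j) = p := by
  conv_rhs => rw [hp.as_sum]
  rw [cellPoly, Finset.sum_range]

/-- Deleting the last row and first column leaves a lower triangular matrix with `-1` on the
diagonal. This unit minor forces all invariant factors but the last to be `1`. -/
theorem det_charmatrix_naturalCell_submatrix {k : ℕ} (a : Fin (k + 1) → ℝ) :
    ((naturalCell a).charmatrix.submatrix Fin.castSucc Fin.succ).det = (-1) ^ k := by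
  rw [det_of_isLowerTriangular]
  · rw [Finset.prod_eq_pow_card (b := (-1 : ℝ[X]))]
    · simp
    · intro i _
      have h : (i.castSucc : Fin (k + 1)) ≠ i.succ := Fin.castSucc_lt_succ.ne
      simp [charmatrix_apply_ne _ _ _ h, naturalCell, i.isLt.ne]
  · intro i j hij
    have hij' : (i : ℕ) < j := hij
    have h : (i.castSucc : Fin (k + 1)) ≠ j.succ := by
      simp only [ne_eq, Fin.ext_iff, Fin.val_castSucc, Fin.val_succ]; omega
    simp [charmatrix_apply_ne _ _ _ h, naturalCell, i.isLt.ne, hij'.ne]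

/-- Rows above the last cancel `X * X ^ i` against `X ^ (i + 1)`. Applying the adjugate and reading
entry `0` then gives the characteristic polynomial. -/
theorem charmatrix_naturalCell_mulVec {k : ℕ} (a : Fin (k + 1) → ℝ) :
    (naturalCell a).charmatrix *ᵥ (fun i => X ^ (i : ℕ)) =
      Pi.single (Fin.last k) (cellPoly a) := by
  funext i
  rw [charmatrix, sub_mulVec, Pi.sub_apply, scalar_apply, mulVec_diagonal, ← pow_succ']
  refine Fin.lastCases ?_ (fun i => ?_) i
  · simp [mulVec, dotProduct, naturalCell, cellPoly, Finset.sum_neg_distrib]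
  · rw [Pi.single_eq_of_ne (Fin.castSucc_lt_last i).ne, mulVec, dotProduct,
      Finset.sum_eq_single i.succ]
    · simp [naturalCell, i.isLt.ne]
    · intro j _ hj
      have : (i : ℕ) + 1 ≠ j := fun h => hj (Fin.ext h.symm)
      simp [naturalCell, i.isLt.ne, this]
    · simp

theorem charpoly_naturalCell {k : ℕ} (a : Fin k → ℝ) : (naturalCell a).charpoly = cellPoly a := by
  cases k with
  | zero => simp [charpoly, cellPoly]
  | succ k =>
    have h := congrArg (fun v => ((naturalCell a).charmatrix.adjugate *ᵥ v) 0)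
      (charmatrix_naturalCell_mulVec a)
    simp only [mulVec_mulVec, adjugate_mul, smul_mulVec, one_mulVec, mulVec_single,
      Pi.smul_apply, col_apply, adjugate_fin_succ_eq_det_submatrix, Fin.succAbove_last,
      Fin.succAbove_zero, det_charmatrix_naturalCell_submatrix] at h
    refine eq_of_monic_of_associated (charpoly_monic _) (cellPoly_monic a) ?_
    simp only [Fin.val_zero, pow_zero, smul_eq_mul, mul_one, Fin.val_last, add_zero,
      MulOpposite.smul_eq_mul_unop, MulOpposite.unop_op, ← pow_add, Even.neg_one_pow ⟨k, rfl⟩,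
      one_mul] at h
    exact h ▸ Associated.refl _

theorem charmatrix_naturalCell_matEquiv {k : ℕ} (a : Fin k → ℝ) :
    MatEquiv (naturalCell a).charmatrix
      (diagonal fun i : Fin k => if (i : ℕ) + 1 = k then cellPoly a else 1) := by
  obtain ⟨hd, hm, h⟩ := charmatrix_matEquiv_diagonal_invariantFactors (naturalCell a)
  generalize invariantFactors (naturalCell a) = d at hd hm h
  cases k with
  | zero => exact Subsingleton.elim (diagonal d) (diagonal _) ▸ h
  | succ k =>
    have hmin : minorsGCD (naturalCell a).charmatrix k ∣ (-1) ^ k := by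
      rw [← det_charmatrix_naturalCell_submatrix a]
      exact dvd_minorsGCD_iff.1 dvd_rfl (Fin.castLEOrderEmb k.le_succ) (Fin.succOrderEmb k)
    rw [h.minorsGCD_eq, minorsGCD_diagonal hd hm k.le_succ] at hmin
    have hone : ∀ i : Fin k, d i.castSucc = 1 := fun i =>
      (hm _).eq_one_of_isUnit (isUnit_of_dvd_unit
        ((Finset.dvd_prod_of_mem (fun i : Fin k => d (i.castLE k.le_succ))
          (Finset.mem_univ i)).trans hmin) (isUnit_one.neg.pow k))
    have hlast : d (Fin.last k) = cellPoly a := by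
      have hdet := h.associated_det
      rw [det_diagonal, Fin.prod_univ_castSucc] at hdet
      simp only [hone, Finset.prod_const_one, one_mul] at hdet
      rw [← charpoly_naturalCell a]
      exact (eq_of_monic_of_associated (charpoly_monic _) (hm _) hdet).symm
    convert h using 3 with i
    refine Fin.lastCases ?_ (fun i => ?_) i
    · simp [hlast]
    · simp [hone, i.isLt.ne]

theorem trace_naturalCell {k : ℕ} (a : Fin (k + 1) → ℝ) :
    (naturalCell a).trace = -a (Fin.last k) := by
  rw [trace, Fin.sum_univ_castSucc]
  simp [naturalCell, Nat.ne_of_lt]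

end Cells

/-! ### Characteristic matrix and trace of a block sum -/

section Blocks

variable {m n : ℕ}

theorem charmatrix_blockDiagonal' {o : Type*} [Fintype o] [DecidableEq o] {l : o → Type*}
    [∀ i, Fintype (l i)] [∀ i, DecidableEq (l i)] {K : Type*} [CommRing K]
    (A : ∀ i, Matrix (l i) (l i) K) :
    (blockDiagonal' A).charmatrix = blockDiagonal' fun i => (A i).charmatrix := by
  have h1 : ∀ i, (A i).charmatrix = diagonal (fun _ => X) - (A i).map C := fun i => rfl
  have h2 : (blockDiagonal' A).charmatrix = diagonal (fun _ => X) - (blockDiagonal' A).map C := rfl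
  simp only [h2, h1]
  rw [blockDiagonal'_map _ _ (map_zero C)]
  rw [← blockDiagonal'_diagonal (fun i (_ : l i) => (X : K[X])), ← blockDiagonal'_sub]
  rfl

theorem trace_diagBlocks (s : Fin m → ℕ) (h : ∑ i, s i = n)
    (A : (i : Fin m) → Matrix (Fin (s i)) (Fin (s i)) ℝ) :
    (diagBlocks s h A).trace = ∑ i, (A i).trace := by
  rw [← trace_blockDiagonal', diagBlocks, trace, trace]
  exact Equiv.sum_comp (finSigmaFinEquiv.trans (finCongr h)).symm (blockDiagonal' A).diag

end Blocks

/-! ### Rational canonical form: existence and uniqueness -/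

section RationalForm

variable {m n : ℕ}

/-- The block diagonal matrix whose blocks are the natural normal cells of the polynomials `p i`. -/
noncomputable def rationalForm (p : Fin m → ℝ[X]) (h : ∑ i, (p i).natDegree = n) :
    Matrix (Fin n) (Fin n) ℝ :=
  diagBlocks (fun i => (p i).natDegree) h fun i => naturalCell fun j => (p i).coeff j

/-- `R` is the rational canonical form with non-constant invariant factors `p 0 ∣ p 1 ∣ ⋯`. -/
structure IsRationalForm (p : Fin m → ℝ[X]) (R : Matrix (Fin n) (Fin n) ℝ) : Prop where
  monic : ∀ i, (p i).Monic
  natDegree_pos : ∀ i, 0 < (p i).natDegree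
  dvd : ∀ i j, i ≤ j → p i ∣ p j
  eq : ∃ h, R = rationalForm p h

/-- The sequence `1, …, 1, p 0, …, p (m-1)` of length `n`. -/
noncomputable def padOnes (p : Fin m → ℝ[X]) (n : ℕ) : Fin n → ℝ[X] :=
  fun k => if h : n ≤ k + m then p ⟨k + m - n, by omega⟩ else 1

theorem padOnes_of_add_eq (p : Fin m → ℝ[X]) {k : Fin n} {i : Fin m} (h : (k : ℕ) + m = n + i) :
    padOnes p n k = p i := by
  rw [padOnes, dif_pos (by omega)]
  congr 1
  ext
  simp only
  omega

theorem padOnes_of_lt (p : Fin m → ℝ[X]) {k : Fin n} (h : (k : ℕ) + m < n) :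
    padOnes p n k = 1 := dif_neg (by omega)

theorem padOnes_monic {p : Fin m → ℝ[X]} (hp : ∀ i, (p i).Monic) (k : Fin n) :
    (padOnes p n k).Monic := by
  rw [padOnes]
  split_ifs
  exacts [hp _, monic_one]

theorem padOnes_dvd {p : Fin m → ℝ[X]} (hp : ∀ i j, i ≤ j → p i ∣ p j) (k l : Fin n)
    (hkl : k ≤ l) : padOnes p n k ∣ padOnes p n l := by
  have hkl' : (k : ℕ) ≤ l := hkl
  rw [padOnes, padOnes]
  split_ifs with h1 h2
  · exact hp _ _ (by simp only [Fin.mk_le_mk]; omega)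
  · omega
  · exact one_dvd _
  · exact one_dvd _

theorem exists_equiv_extend {ι α β : Type*} [Fintype α] [Fintype β]
    (hc : Fintype.card α = Fintype.card β) {f : ι → α} {g : ι → β} (hf : Function.Injective f)
    (hg : Function.Injective g) : ∃ σ : α ≃ β, ∀ i, σ (f i) = g i := by
  classical
  rcases isEmpty_or_nonempty ι with hι | hι
  · exact ⟨Fintype.equivOfCardEq hc, fun i => (IsEmpty.false i).elim⟩
  obtain ⟨σ, hσ⟩ := Set.MapsTo.exists_equiv_extend_of_card_eq (t := (Finset.univ : Finset β))
    (by simpa using hc) (s := Set.range f) (f := g ∘ Function.invFun f) (by simp [Set.MapsTo])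
    (by
      rintro _ ⟨i, rfl⟩ _ ⟨j, rfl⟩ hij
      simp only [Function.comp_apply, Function.leftInverse_invFun hf _] at hij
      rw [hg hij])
  refine ⟨σ.trans (Equiv.subtypeUnivEquiv Finset.mem_univ), fun i => ?_⟩
  have := hσ (f i) ⟨i, rfl⟩
  rw [Function.comp_apply, Function.leftInverse_invFun hf] at this
  exact this

theorem card_le_of_natDegree_pos {p : Fin m → ℝ[X]} (hp : ∀ i, 0 < (p i).natDegree)
    (h : ∑ i, (p i).natDegree = n) : m ≤ n := by
  have := Finset.card_nsmul_le_sum Finset.univ (fun i => (p i).natDegree) 1 fun i _ => hp i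
  simpa [h] using this

/-- Each block contributes `1, …, 1, p i`; a permutation moves the `p i` to the last `m` places. -/
theorem charmatrix_rationalForm_matEquiv {p : Fin m → ℝ[X]} (hm : ∀ i, (p i).Monic)
    (hp : ∀ i, 0 < (p i).natDegree) (h : ∑ i, (p i).natDegree = n) :
    MatEquiv (rationalForm p h).charmatrix (diagonal (padOnes p n)) := by
  have hmn := card_le_of_natDegree_pos hp h
  let e : (Σ i, Fin (p i).natDegree) ≃ Fin n := finSigmaFinEquiv.trans (finCongr h)
  let g : (Σ i, Fin (p i).natDegree) → ℝ[X] :=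
    fun x => if (x.2 : ℕ) + 1 = (p x.1).natDegree then p x.1 else 1
  have h1 : MatEquiv (rationalForm p h).charmatrix (diagonal (g ∘ e.symm)) := by
    rw [rationalForm, diagBlocks, charmatrix_reindex, charmatrix_blockDiagonal']
    have hb := MatEquiv.blockDiagonal' fun i =>
      charmatrix_naturalCell_matEquiv fun j : Fin (p i).natDegree => (p i).coeff j
    simp only [cellPoly_coeff (hm _)] at hb
    rw [blockDiagonal'_diagonal] at hb
    have hs := hb.submatrix_equiv e.symm
    rwa [submatrix_diagonal_equiv] at hs
  let f : Fin m → Fin n := fun i => e ⟨i, ⟨(p i).natDegree - 1, by have := hp i; omega⟩⟩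
  let f' : Fin m → Fin n := fun i => ⟨n - m + i, by omega⟩
  have hf : Function.Injective f := fun i j hij => congrArg Sigma.fst (e.injective hij)
  have hf' : Function.Injective f' := fun i j hij => by
    simp only [f', Fin.mk.injEq] at hij
    exact Fin.ext (by omega)
  -- `σ` sends the `i`-th of the last `m` places to the last position of block `i`.
  obtain ⟨σ, hσ⟩ := exists_equiv_extend rfl hf' hf
  have h2 := matEquiv_submatrix_perm (diagonal (g ∘ e.symm)) σ σ
  rw [submatrix_diagonal_equiv] at h2
  convert h1.trans h2 using 2
  funext k
  by_cases hk : n ≤ k + m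
  · let i : Fin m := ⟨k + m - n, by omega⟩
    have hki : k = f' i := Fin.ext (by simp only [f', i]; omega)
    have hgi : (g ∘ e.symm) (f i) = p i := by
      have := hp i
      change g (e.symm (e _)) = p i
      rw [e.symm_apply_apply]
      exact if_pos (by simp only; omega)
    rw [padOnes_of_add_eq p (i := i) (by simp only [i]; omega), Function.comp_apply, hki, hσ, hgi]
  · rw [padOnes_of_lt p (by omega), Function.comp_apply, Function.comp_apply]
    symm
    refine if_neg fun hx => hk ?_
    have : σ k = f (e.symm (σ k)).1 := by
      apply e.symm.injective
      simp only [f, Equiv.symm_apply_apply]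
      refine Sigma.ext rfl (heq_of_eq (Fin.ext ?_))
      simp only
      omega
    rw [← hσ] at this
    rw [σ.injective this]
    simp only [f']
    omega

theorem IsRationalForm.invariantFactors_eq {p : Fin m → ℝ[X]} {R : Matrix (Fin n) (Fin n) ℝ}
    (hR : IsRationalForm p R) : invariantFactors R = padOnes p n := by
  obtain ⟨h, rfl⟩ := hR.eq
  rw [invariantFactors,
    (charmatrix_rationalForm_matEquiv hR.monic hR.natDegree_pos h).polyInvariantFactors_eq,
    polyInvariantFactors_diagonal (padOnes_dvd hR.dvd) (padOnes_monic hR.monic)]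

theorem IsRationalForm.card_le {p : Fin m → ℝ[X]} {R : Matrix (Fin n) (Fin n) ℝ}
    (hR : IsRationalForm p R) : m ≤ n := by
  obtain ⟨h, -⟩ := hR.eq
  exact card_le_of_natDegree_pos hR.natDegree_pos h

/-- If `m < m'`, place `n - m'` carries `1` on one side and the nonconstant `p' 0` on the other. -/
theorem card_le_of_padOnes_eq {m' : ℕ} {p : Fin m → ℝ[X]} {p' : Fin m' → ℝ[X]}
    (hp' : ∀ i, 0 < (p' i).natDegree) (hn : m' ≤ n) (h : padOnes p n = padOnes p' n) :
    m' ≤ m := by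
  by_contra! hlt
  have hk := congrFun h ⟨n - m', by omega⟩
  rw [padOnes_of_lt p (by simp only; omega),
    padOnes_of_add_eq p' (i := ⟨0, by omega⟩) (by simp only; omega)] at hk
  have := hp' ⟨0, by omega⟩
  rw [← hk] at this
  simp at this

theorem IsRationalForm.card_eq_of_isConj {m' : ℕ} {p : Fin m → ℝ[X]} {p' : Fin m' → ℝ[X]}
    {R R' : Matrix (Fin n) (Fin n) ℝ} (hR : IsRationalForm p R) (hR' : IsRationalForm p' R')
    (h : IsConj R R') : m = m' := by
  have hpad : padOnes p n = padOnes p' n := by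
    rw [← hR.invariantFactors_eq, ← hR'.invariantFactors_eq]
    exact (isConj_iff_invariantFactors_eq R R').1 h
  exact le_antisymm (card_le_of_padOnes_eq hR.natDegree_pos hR.card_le hpad.symm)
    (card_le_of_padOnes_eq hR'.natDegree_pos hR'.card_le hpad)

theorem IsRationalForm.eq_of_isConj {p p' : Fin m → ℝ[X]}
    {R R' : Matrix (Fin n) (Fin n) ℝ} (hR : IsRationalForm p R) (hR' : IsRationalForm p' R')
    (h : IsConj R R') : p = p' := by
  have hpad : padOnes p n = padOnes p' n := by
    rw [← hR.invariantFactors_eq, ← hR'.invariantFactors_eq]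
    exact (isConj_iff_invariantFactors_eq R R').1 h
  have hmn := hR.card_le
  funext i
  have hk := congrFun hpad ⟨n - m + i, by omega⟩
  rwa [padOnes_of_add_eq p (i := i) (by simp only; omega),
    padOnes_of_add_eq p' (i := i) (by simp only; omega)] at hk

/-- Existence of the rational canonical form. -/
theorem exists_isRationalForm (A : Matrix (Fin n) (Fin n) ℝ) :
    ∃ (m : ℕ) (p : Fin m → ℝ[X]) (R : Matrix (Fin n) (Fin n) ℝ),
      IsRationalForm p R ∧ IsConj A R := by
  obtain ⟨hd, hm, hA⟩ := charmatrix_matEquiv_diagonal_invariantFactors A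
  generalize invariantFactors A = d at hd hm hA
  have hdeg : ∑ k, (d k).natDegree = n := by
    have hdet := hA.associated_det
    rw [det_diagonal] at hdet
    have := eq_of_monic_of_associated (charpoly_monic A)
      (monic_prod_of_monic _ _ fun i _ => hm i) hdet
    rw [← natDegree_prod_of_monic _ _ fun i _ => hm i, ← this, charpoly_natDegree_eq_dim,
      Fintype.card_fin]
  -- `t` counts the leading factors equal to `1`; divisibility prevents a `1` from recurring later.
  obtain ⟨t, htn, hlt, hge⟩ : ∃ t ≤ n, (∀ k : Fin n, (k : ℕ) < t → d k = 1) ∧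
      ∀ k : Fin n, t ≤ k → d k ≠ 1 := by
    classical
    have hex : ∃ t, ∀ h : t < n, d ⟨t, h⟩ ≠ 1 := ⟨n, fun h => absurd h (lt_irrefl n)⟩
    refine ⟨Nat.find hex, Nat.find_min' hex fun h => absurd h (lt_irrefl n), fun k hk => ?_,
      fun k hk h1 => ?_⟩
    · have := Nat.find_min hex hk
      push Not at this
      exact this.2
    · have hlt := lt_of_le_of_lt hk k.isLt
      refine Nat.find_spec hex hlt ((hm _).eq_one_of_isUnit (isUnit_of_dvd_one ?_))
      exact (hd ⟨_, hlt⟩ k hk).trans h1.dvd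
  obtain ⟨m, rfl⟩ := Nat.exists_eq_add_of_le htn
  let p : Fin m → ℝ[X] := fun i => d (Fin.natAdd t i)
  have hpos : ∀ i, 0 < (p i).natDegree := fun i => by
    refine Nat.pos_of_ne_zero fun h0 => hge (Fin.natAdd t i) (by simp) ?_
    exact (hm _).natDegree_eq_zero.1 h0
  have hsum : ∑ i, (p i).natDegree = t + m := by
    rw [Fin.sum_univ_add] at hdeg
    simpa [hlt] using hdeg
  have hpad : padOnes p (t + m) = d := by
    funext k
    refine Fin.addCases (fun i => ?_) (fun i => ?_) k
    · rw [padOnes_of_lt p (by simp), hlt _ (by simp)]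
    · rw [padOnes_of_add_eq p (i := i) (by simp; omega)]
  refine ⟨m, p, rationalForm p hsum, ⟨fun i => hm _, hpos, fun i j hij => hd _ _ ?_, hsum, rfl⟩, ?_⟩
  · simpa using hij
  · refine isConj_of_matEquiv_charmatrix (hA.trans ?_)
    rw [← hpad]
    exact (charmatrix_rationalForm_matEquiv (fun i => hm _) hpos hsum).symm

end RationalForm

/-! ### The families as traceless rational forms -/

section Families

variable {m n : ℕ}

theorem diagBlocks_apply (s : Fin m → ℕ) (h : ∑ i, s i = n)
    (A : (i : Fin m) → Matrix (Fin (s i)) (Fin (s i)) ℝ) (x y : Σ i, Fin (s i)) :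
    diagBlocks s h A (finCongr h (finSigmaFinEquiv x)) (finCongr h (finSigmaFinEquiv y)) =
      blockDiagonal' A x y := by
  simp [diagBlocks]

/-- Fewer than `n` blocks force one of size at least `2`, whose superdiagonal contains a `1`. -/
theorem rationalForm_ne_zero {p : Fin m → ℝ[X]} (h : ∑ i, (p i).natDegree = n) (hmn : m < n) :
    rationalForm p h ≠ 0 := by
  obtain ⟨i, hi⟩ : ∃ i, 1 < (p i).natDegree := by
    by_contra! hcon
    have := Finset.sum_le_card_nsmul Finset.univ (fun i => (p i).natDegree) 1 fun i _ => hcon i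
    simp [h] at this
    omega
  intro h0
  have := diagBlocks_apply _ h (fun i => naturalCell fun j : Fin (p i).natDegree => (p i).coeff j)
    ⟨i, ⟨0, by omega⟩⟩ ⟨i, ⟨1, hi⟩⟩
  change rationalForm p h _ _ = _ at this
  rw [h0, blockDiagonal'_apply_eq] at this
  simp [naturalCell, hi.ne] at this

theorem dvd_of_le_of_dvd_succ {p : Fin m → ℝ[X]}
    (hp : ∀ i j : Fin m, (j : ℕ) = (i : ℕ) + 1 → p i ∣ p j) (i j : Fin m) (hij : i ≤ j) :
    p i ∣ p j := by
  obtain ⟨j, hj⟩ := j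
  have hij' : (i : ℕ) ≤ j := hij
  induction j, hij' using Nat.le_induction with
  | base => exact dvd_rfl
  | succ j hj' ih => exact (ih (by omega) hj').trans (hp ⟨j, by omega⟩ ⟨j + 1, hj⟩ rfl)

theorem exists_isRationalForm_of_mem_blockFamily {s : sizeTuples m n}
    {R : Matrix (Fin n) (Fin n) ℝ} (hR : R ∈ blockFamily s) :
    ∃ p : Fin m → ℝ[X], IsRationalForm p R ∧ (s.1 = fun i => (p i).natDegree) ∧ R.trace = 0 := by
  obtain ⟨s, hpos, hmono, hsum⟩ := s
  obtain ⟨A, hA, hdvd, htr, rfl⟩ := hR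
  choose a ha using hA
  obtain rfl : A = fun i => naturalCell (a i) := funext ha
  simp only [charpoly_naturalCell] at hdvd
  have hs : s = fun i => (cellPoly (a i)).natDegree :=
    funext fun i => (natDegree_cellPoly (a i)).symm
  refine ⟨fun i => cellPoly (a i), ⟨fun i => cellPoly_monic _, fun i => ?_,
    dvd_of_le_of_dvd_succ hdvd, by rwa [hs] at hsum, ?_⟩, hs, ?_⟩
  · rw [natDegree_cellPoly]
    exact hpos i
  -- The sizes occur in the types of the blocks, so the size function is generalized before
  -- substituting.
  · have key : ∀ (s' : Fin m → ℕ) (hs' : s = s') (h' : ∑ i, s' i = n),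
        diagBlocks s hsum (fun i => naturalCell (a i)) =
          diagBlocks s' h' fun i => naturalCell fun j => (cellPoly (a i)).coeff j := by
      rintro _ rfl _
      simp only [coeff_cellPoly]
    exact key _ hs _
  · rw [trace_diagBlocks]
    exact htr

theorem IsRationalForm.mem_blockFamily {p : Fin m → ℝ[X]} {R : Matrix (Fin n) (Fin n) ℝ}
    (hR : IsRationalForm p R) (htr : R.trace = 0) :
    ∃ s : sizeTuples m n, R ∈ blockFamily s := by
  obtain ⟨h, rfl⟩ := hR.eq
  refine ⟨⟨fun i => (p i).natDegree, hR.natDegree_pos, fun i j hij =>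
    natDegree_le_of_dvd (hR.dvd i j hij) (hR.monic j).ne_zero, h⟩,
    fun i => naturalCell fun j => (p i).coeff j, fun i => ⟨_, rfl⟩, fun i j hij => ?_, ?_, rfl⟩
  · rw [charpoly_naturalCell, charpoly_naturalCell, cellPoly_coeff (hR.monic i),
      cellPoly_coeff (hR.monic j)]
    exact hR.dvd i j (by rw [Fin.le_def]; omega)
  · exact (trace_diagBlocks _ h _).symm.trans htr

/-- This lets the single-cell family be treated as the case `m = 1` of the rational form. -/
theorem diagBlocks_one (a : Fin n → ℝ) (s : Fin 1 → ℕ) (h : ∑ i, s i = n) :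
    diagBlocks s h (fun i => naturalCell fun j : Fin (s i) =>
      a ⟨j, by rw [← h, Fin.sum_univ_one]; exact Subsingleton.elim i 0 ▸ j.isLt⟩) =
      naturalCell a := by
  ext i j
  obtain ⟨⟨i₀, i⟩, rfl⟩ := (finSigmaFinEquiv.trans (finCongr h)).surjective i
  obtain ⟨⟨j₀, j⟩, rfl⟩ := (finSigmaFinEquiv.trans (finCongr h)).surjective j
  obtain rfl : i₀ = 0 := Subsingleton.elim _ _
  obtain rfl : j₀ = 0 := Subsingleton.elim _ _
  rw [Equiv.trans_apply, Equiv.trans_apply, diagBlocks_apply, blockDiagonal'_apply_eq]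
  have h0 : s 0 = n := by rw [← h, Fin.sum_univ_one]
  have hj : finCongr h (finSigmaFinEquiv ⟨0, j⟩) = ⟨j, by omega⟩ :=
    Fin.ext (finSigmaFinEquiv_one ⟨0, j⟩)
  have hi : finCongr h (finSigmaFinEquiv ⟨0, i⟩) = ⟨i, by omega⟩ :=
    Fin.ext (finSigmaFinEquiv_one ⟨0, i⟩)
  simp only [hi, hj, naturalCell, of_apply, h0]

theorem exists_isRationalForm_of_mem_cellFamily (hn : 0 < n)
    {R : Matrix (Fin n) (Fin n) ℝ} (hR : R ∈ cellFamily n) :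
    ∃ p : Fin 1 → ℝ[X], IsRationalForm p R ∧ R.trace = 0 := by
  obtain ⟨a, ha, rfl⟩ := hR
  refine ⟨fun _ => cellPoly a, ⟨fun _ => cellPoly_monic a, fun _ => ?_, fun _ _ _ => dvd_rfl,
    by simp [natDegree_cellPoly], ?_⟩, ?_⟩
  · rwa [natDegree_cellPoly]
  · rw [rationalForm, ← diagBlocks_one a (fun _ => (cellPoly a).natDegree)
      (by simp [natDegree_cellPoly])]
    congr 1
    funext i
    congr 1
    funext j
    exact (coeff_cellPoly a ⟨j, _⟩).symm
  · obtain ⟨k, rfl⟩ := Nat.exists_eq_succ_of_ne_zero hn.ne'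
    rw [trace_naturalCell, ha _ rfl, neg_zero]

theorem IsRationalForm.mem_cellFamily {p : Fin 1 → ℝ[X]} {R : Matrix (Fin n) (Fin n) ℝ}
    (hR : IsRationalForm p R) (htr : R.trace = 0) : R ∈ cellFamily n := by
  obtain ⟨h, rfl⟩ := hR.eq
  have hR' : rationalForm p h = naturalCell fun j : Fin n => (p 0).coeff j := by
    rw [rationalForm, ← diagBlocks_one _ (fun i => (p i).natDegree) h]
    congr 1
    funext i
    rw [Subsingleton.elim i 0]
  refine ⟨_, fun i hi => ?_, hR'⟩
  obtain ⟨k, rfl⟩ : ∃ k, n = k + 1 := ⟨i, hi.symm⟩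
  rw [hR', trace_naturalCell, neg_eq_zero] at htr
  obtain rfl : i = Fin.last k := Fin.ext (by simp at hi ⊢; omega)
  exact htr

theorem exists_isRationalForm_of_mem_family (hn : 2 ≤ n) {c : FamilyIndex n}
    {R : Matrix (Fin n) (Fin n) ℝ} (hR : R ∈ family c) :
    ∃ (m : ℕ) (p : Fin m → ℝ[X]), IsRationalForm p R ∧ R.trace = 0 ∧ m < n ∧
      ((m = 1 ∧ c = .cell) ∨ ∃ (h : 1 < m) (h' : m < n) (s : sizeTuples m n),
        c = .blocks m h h' s ∧ s.1 = fun i => (p i).natDegree) := by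
  cases c with
  | cell =>
    obtain ⟨p, hp, htr⟩ := exists_isRationalForm_of_mem_cellFamily (by omega) hR
    exact ⟨1, p, hp, htr, by omega, Or.inl ⟨rfl, rfl⟩⟩
  | blocks m h h' s =>
    obtain ⟨p, hp, hs, htr⟩ := exists_isRationalForm_of_mem_blockFamily hR
    exact ⟨m, p, hp, htr, h', Or.inr ⟨h, h', s, rfl, hs⟩⟩

/-- Similarity determines the polynomials `p`, and these determine `m`, the block sizes and the
matrix. Taking `R = R'` gives disjointness of the families. -/
theorem mem_family_unique (hn : 2 ≤ n) {c d : FamilyIndex n} {R R' : Matrix (Fin n) (Fin n) ℝ}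
    (hR : R ∈ family c) (hR' : R' ∈ family d) (h : IsConj R R') : c = d ∧ R = R' := by
  obtain ⟨m, p, hp, -, -, hc⟩ := exists_isRationalForm_of_mem_family hn hR
  obtain ⟨m', p', hp', -, -, hd⟩ := exists_isRationalForm_of_mem_family hn hR'
  obtain rfl := hp.card_eq_of_isConj hp' h
  obtain rfl := hp.eq_of_isConj hp' h
  refine ⟨?_, ?_⟩
  · rcases hc with ⟨rfl, rfl⟩ | ⟨h1, -, s, rfl, hs⟩ <;>
      rcases hd with ⟨h1', rfl⟩ | ⟨h1', -, s', rfl, hs'⟩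
    · rfl
    · omega
    · omega
    · obtain rfl : s = s' := Subtype.ext (hs.trans hs'.symm)
      rfl
  · obtain ⟨_, h1⟩ := hp.eq
    obtain ⟨_, h2⟩ := hp'.eq
    rw [h1, h2]

theorem sizeTuples_self (n : ℕ) : sizeTuples n n = {fun _ => 1} := by
  ext s
  simp only [sizeTuples, Set.mem_ofPred_eq, Set.mem_singleton_iff]
  constructor
  · rintro ⟨hpos, -, hsum⟩
    have h := (Finset.sum_eq_sum_iff_of_le (s := Finset.univ) (f := fun _ : Fin n => 1) (g := s)
      fun i _ => hpos i).1 (by simp [hsum])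
    exact funext fun i => (h i (Finset.mem_univ i)).symm
  · rintro rfl
    exact ⟨fun _ => one_pos, monotone_const, by simp⟩

theorem naturalCell_coeff_X :
    (naturalCell fun j : Fin (X : ℝ[X]).natDegree => (X : ℝ[X]).coeff j) = 0 := by
  have key : ∀ k, k = 1 → (naturalCell fun j : Fin k => (X : ℝ[X]).coeff j) = 0 := by
    rintro _ rfl
    ext i j
    fin_cases i
    fin_cases j
    simp [naturalCell]
  exact key _ natDegree_X

theorem rationalForm_X (h : ∑ _i : Fin m, (X : ℝ[X]).natDegree = n) :
    rationalForm (fun _ : Fin m => X) h = 0 := by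
  rw [rationalForm, naturalCell_coeff_X, diagBlocks]
  have : blockDiagonal' (fun _ : Fin m =>
      (0 : Matrix (Fin (X : ℝ[X]).natDegree) (Fin (X : ℝ[X]).natDegree) ℝ)) = 0 :=
    blockDiagonal'_zero
  rw [this]
  rfl

theorem trace_naturalCell_of_natDegree_eq_one {p : ℝ[X]} (hp : p.natDegree = 1) :
    (naturalCell fun j : Fin p.natDegree => p.coeff j).trace = -p.coeff 0 := by
  have key : ∀ k, k = 1 → (naturalCell fun j : Fin k => p.coeff j).trace = -p.coeff 0 := by
    rintro _ rfl
    rw [trace_naturalCell]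
    rfl
  exact key _ hp

theorem blockFamily_eq_zero (hn : 0 < n) (s : sizeTuples n n) : blockFamily s = {0} := by
  have hs1 : ∀ s : sizeTuples n n, s.1 = fun _ => 1 := fun s => (sizeTuples_self n).subset s.2
  ext R
  rw [Set.mem_singleton_iff]
  constructor
  · intro hR
    obtain ⟨p, hp, hs, htr⟩ := exists_isRationalForm_of_mem_blockFamily hR
    obtain ⟨h, rfl⟩ := hp.eq
    have hdeg : ∀ i, (p i).natDegree = 1 := fun i => (congrFun (hs.symm.trans (hs1 s)) i)
    let i₀ : Fin n := ⟨0, hn⟩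
    -- Monic linear polynomials dividing one another coincide, so the trace is `n` times one
    -- coefficient, up to sign.
    have hp0 : ∀ i, p i = p i₀ := fun i =>
      (eq_of_monic_of_dvd_of_natDegree_le (hp.monic i₀) (hp.monic i)
        (hp.dvd i₀ i (Nat.zero_le _)) (by rw [hdeg, hdeg]))
    have hc : (p i₀).coeff 0 = 0 := by
      rw [rationalForm, trace_diagBlocks] at htr
      simp only [trace_naturalCell_of_natDegree_eq_one (hdeg _)] at htr
      simpa [hp0, hn.ne'] using htr
    have hX : p = fun _ => X := by
      funext i
      rw [hp0 i, (hp.monic i₀).eq_X_add_C (hdeg i₀), hc, C_0, add_zero]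
    subst hX
    exact rationalForm_X h
  · rintro rfl
    have h : ∑ i : Fin n, (X : ℝ[X]).natDegree = n := by simp
    have hp : IsRationalForm (fun _ : Fin n => (X : ℝ[X])) (0 : Matrix (Fin n) (Fin n) ℝ) :=
      ⟨fun _ => monic_X, fun _ => by simp, fun _ _ _ => dvd_rfl, h, (rationalForm_X h).symm⟩
    obtain ⟨s', hs'⟩ := hp.mem_blockFamily (by simp)
    obtain rfl : s' = s := Subtype.ext ((hs1 s').trans (hs1 s).symm)
    exact hs'

theorem mem_sl_iff_trace_eq_zero (A : Matrix (Fin n) (Fin n) ℝ) :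
    A ∈ LieAlgebra.SpecialLinear.sl (Fin n) ℝ ↔ A.trace = 0 := Iff.rfl

theorem trace_eq_of_isConj {A B : Matrix (Fin n) (Fin n) ℝ} (h : IsConj A B) :
    A.trace = B.trace := by
  obtain ⟨P, hP⟩ := h
  have hB : B = P.1 * A * (P⁻¹ : (Matrix (Fin n) (Fin n) ℝ)ˣ).1 := by
    rw [hP.eq, Matrix.mul_assoc, Units.mul_inv, Matrix.mul_one]
  rw [hB, trace_units_conj]

theorem exists_mem_family_isConj (hn : 2 ≤ n) {A : Matrix (Fin n) (Fin n) ℝ} (htr : A.trace = 0)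
    (hA : A ≠ 0) : ∃ R, (∃ c, R ∈ family c) ∧ IsConj A R := by
  obtain ⟨m, p, R, hR, hAR⟩ := exists_isRationalForm A
  rw [trace_eq_of_isConj hAR] at htr
  have hmn := hR.card_le
  have hm0 : m ≠ 0 := by
    rintro rfl
    obtain ⟨h, -⟩ := hR.eq
    simp at h
    omega
  refine ⟨R, ?_, hAR⟩
  obtain rfl | hm1 := eq_or_ne m 1
  · exact ⟨.cell, hR.mem_cellFamily htr⟩
  obtain ⟨s, hs⟩ := hR.mem_blockFamily htr
  obtain rfl | hne := eq_or_ne m n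
  -- With `m = n` the form is zero, and only zero is similar to zero.
  · rw [blockFamily_eq_zero (by omega) s, Set.mem_singleton_iff] at hs
    subst hs
    obtain ⟨P, hP⟩ := hAR
    exact absurd (P.isUnit.mul_right_eq_zero.1 (hP.eq.trans (zero_mul _))) hA
  · exact ⟨.blocks m (by omega) (by omega) s, hs⟩

end Families

end SlClasses

theorem mainTheorem3 (n : ℕ) (hn : 2 ≤ n) :
    -- the listed matrices are nonzero elements of `sl(n, ℝ)`
    (∀ (c : SlClasses.FamilyIndex n), ∀ R ∈ SlClasses.family c,
      R ∈ LieAlgebra.SpecialLinear.sl (Fin n) ℝ ∧ R ≠ 0) ∧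
    -- families with different labels have no matrix in common
    (∀ c d : SlClasses.FamilyIndex n, c ≠ d →
      Disjoint (SlClasses.family c) (SlClasses.family d)) ∧
    -- every nonzero element of `sl(n, ℝ)` is similar to exactly one listed matrix
    (∀ X ∈ LieAlgebra.SpecialLinear.sl (Fin n) ℝ, X ≠ 0 →
      ∃! R : Matrix (Fin n) (Fin n) ℝ, (∃ c, R ∈ SlClasses.family c) ∧ IsConj X R) ∧
    -- the excluded value `m = n` gives the zero matrix only
    (SlClasses.sizeTuples n n = {fun _ => 1} ∧
      ∀ s : SlClasses.sizeTuples n n, SlClasses.blockFamily s = {0}) ∧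
    -- the similarity classes are determined by the invariant factors
    (∀ X ∈ LieAlgebra.SpecialLinear.sl (Fin n) ℝ,
      ∀ Y ∈ LieAlgebra.SpecialLinear.sl (Fin n) ℝ,
        (IsConj X Y ↔ SlClasses.invariantFactors X = SlClasses.invariantFactors Y)) := by
  refine ⟨fun c R hR => ?_, fun c d hcd => ?_, fun A hA hA0 => ?_,
    ⟨SlClasses.sizeTuples_self n, SlClasses.blockFamily_eq_zero (by omega)⟩,
    fun A _ B _ => SlClasses.isConj_iff_invariantFactors_eq A B⟩
  · obtain ⟨m, p, hp, htr, hmn, -⟩ := SlClasses.exists_isRationalForm_of_mem_family hn hR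
    obtain ⟨h, rfl⟩ := hp.eq
    exact ⟨(SlClasses.mem_sl_iff_trace_eq_zero _).2 htr, SlClasses.rationalForm_ne_zero h hmn⟩
  · rw [Set.disjoint_left]
    intro R hc hd
    exact hcd (SlClasses.mem_family_unique hn hc hd (IsConj.refl R)).1
  · obtain ⟨R, ⟨c, hc⟩, hAR⟩ := SlClasses.exists_mem_family_isConj hn
      ((SlClasses.mem_sl_iff_trace_eq_zero A).1 hA) hA0
    refine ⟨R, ⟨⟨c, hc⟩, hAR⟩, ?_⟩
    rintro R' ⟨⟨d, hd⟩, hAR'⟩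
    exact (SlClasses.mem_family_unique hn hd hc (hAR'.symm.trans hAR)).2
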